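/- Throughout, $\widehat{\mathbb C}=\mathbb C\cup\{\infty\}$ is the Riemann sphere. A polynomial correspondence of degree $d$ is a polynomial $f_d(x,y)=\sum_{0\le i,j\le d}A_{(i,j)}x^iy^j\in\mathbb C[x,y]$ such that the zero set $\Gamma_{f_d}\subset\widehat{\mathbb C}\times\widehat{\mathbb C}$ of its bihomogenisation in bidegree $(d,d)$ contains no component $\{a\}\times\widehat{\mathbb C}$ or $\widehat{\mathbb C}\times\{a\}$, $a\in\widehat{\mathbb C}$. For $x_1\in\widehat{\mathbb C}$ let $Y(x_1)$ be the multiset of the $d$ points $y$ with $(x_1,y)\in\Gamma_{f_d}$, and for $y_1\in\widehat{\mathbb C}$ let $X(y_1)$ be the multiset of the $d$ points $x$ with $(x,y_1)\in\Gamma_{f_d}$, both repeated according to intersection multiplicity (multiplicity as zeros of the restricted form). The correspondence $f_d$ is called a map of $d$-tuples if for every $x_1\in\widehat{\mathbb C}$ the multisets $X(y)$, $y\in Y(x_1)$, all coincide, and for every $y_1\in\widehat{\mathbb C}$ the multisets $Y(x)$, $x\in X(y_1)$, all coincide. (The same definition is used for every degree $k\ge 1$.) **Theorem 2.6.** Let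 $d\ge 2$ and let $f_d$ be a map of $d$-tuples that cannot be written as $f_d=[g_k]^{d/k}$ with $k\mid d$, $k\ne d$ and $g_k\in\mathbb C[x,y]$ a map of $k$-tuples. Then the following statements are equivalent. 1. For all $x,y\in\mathbb C$: $f_d(x,y)=0$ if and only if $f_d(\overline x,\overline y)=0$. 2. There are rational functions of degree $d$, $$\Phi(x)=\frac{\kappa_dx^d+\cdots+\kappa_1x+\kappa_0}{\lambda_dx^d+\cdots+\lambda_1x+\lambda_0},\qquad \Psi(y)=\frac{\mu_dy^d+\cdots+\mu_1y+\mu_0}{\nu_dy^d+\cdots+\nu_1y+\nu_0}$$ (numerator and denominator coprime, the larger of their degrees equal to $d$), with all coefficients $\kappa_i,\lambda_i,\mu_i,\nu_i$ real, such that the equation $f_d(x,y)=0$ can be rewritten as $\Phi(x)=\Psi(y)$, i.e. for all $x,y\in\widehat{\mathbb C}$: $(x,y)\in\Gamma_{f_d}$ if and only if $\Phi(x)=\Psi(y)$ in $\widehat{\mathbb C}$. 3. The $(d+1)\times(d+1)$ matrix of coefficients $\big(A_{(d-i,\,d-j)}\big)_{0\le i,j\le d}$ is real up to multiplication by a constant,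 i.e. it equals $cB$ for some $c\in\mathbb C\setminus\{0\}$ and some real matrix $B$. -/

import Mathlib

open scoped Polynomial.Bivariate

noncomputable section

namespace TupleMap

open Polynomial

/- The Riemann sphere is `OnePoint ℂ`. An element `f` of `ℂ[X][Y]` is a polynomial in `x, y`:
the coefficient of `x ^ i * y ^ j` is `(f.coeff j).coeff i`, its value at `(x, y)` is
`f.evalEval x y`. -/

/-- The matrix of coefficients of `f`: row `i` and column `j` hold `A_(d-i, d-j)`, where `A_(p, q)`
is the coefficient of `x ^ p * y ^ q`. -/
def coeffMatrix (d : ℕ) (f : ℂ[X][Y]) : Matrix (Fin (d + 1)) (Fin (d + 1)) ℂ :=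
  fun i j => (f.coeff (d - (j : ℕ))).coeff (d - (i : ℕ))

/-- A polynomial `p` of degree at most `d` is regarded as a form of degree `d` in two variables
`(ξ, x)`; this is its value at the representative `(1, a)` of a finite point `a`, and at the
representative `(0, 1)` of `∞`. -/
def formEval (d : ℕ) (p : ℂ[X]) : OnePoint ℂ → ℂ
  | none => p.coeff d
  | some a => p.eval a

/-- The zeros on the sphere of a nonzero polynomial of degree at most `d`, regarded as a form of
degree `d`, repeated according to multiplicity (`d` points in all). -/
def zeros (d : ℕ) (p : ℂ[X]) : Multiset (OnePoint ℂ) :=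
  p.roots.map (fun a : ℂ => (a : OnePoint ℂ)) + Multiset.replicate (d - p.natDegree) OnePoint.infty

/-- The restriction of the bihomogenisation of `f` (in bidegree `(d, d)`) to `{a} × sphere`,
a polynomial in `y`: it is `f (a, y)` for finite `a`, and the coefficient of `x ^ d` for `∞`. -/
def sectionX (d : ℕ) (f : ℂ[X][Y]) : OnePoint ℂ → ℂ[X]
  | none => ∑ j ∈ Finset.range (d + 1), C ((f.coeff j).coeff d) * X ^ j
  | some a => f.map (evalRingHom a)

/-- The restriction of the bihomogenisation of `f` (in bidegree `(d, d)`) to `sphere × {b}`,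
a polynomial in `x`: it is `f (x, b)` for finite `b`, and the coefficient of `y ^ d` for `∞`. -/
def sectionY (d : ℕ) (f : ℂ[X][Y]) : OnePoint ℂ → ℂ[X]
  | none => f.coeff d
  | some b => f.eval (C b)

/-- `f` is a polynomial correspondence of degree `d`: it has degree at most `d` in each variable and
its biprojective completion contains no `{a} × sphere` and no `sphere × {b}`, with `a`, `b` finite
or `∞`. (In particular every point then has exactly `d` images and `d` preimages, counted with
multiplicity.) -/
structure IsCorrespondence (d : ℕ) (f : ℂ[X][Y]) : Prop where
  natDegree_y_le : f.natDegree ≤ d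
  natDegree_x_le : ∀ j, (f.coeff j).natDegree ≤ d
  sectionX_ne_zero : ∀ a : OnePoint ℂ, sectionX d f a ≠ 0
  sectionY_ne_zero : ∀ b : OnePoint ℂ, sectionY d f b ≠ 0

/-- The biprojective completion in `sphere × sphere` of the curve `f = 0`: the zero set of the
bihomogenisation of `f` in bidegree `(d, d)`. -/
def completion (d : ℕ) (f : ℂ[X][Y]) : Set (OnePoint ℂ × OnePoint ℂ) :=
  {p | formEval d (sectionX d f p.1) p.2 = 0}

/-- The points `y` with `(x, y)` on the completed curve, repeated according to intersection
multiplicity. -/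
def image (d : ℕ) (f : ℂ[X][Y]) (x : OnePoint ℂ) : Multiset (OnePoint ℂ) :=
  zeros d (sectionX d f x)

/-- The points `x` with `(x, y)` on the completed curve, repeated according to intersection
multiplicity. -/
def preimage (d : ℕ) (f : ℂ[X][Y]) (y : OnePoint ℂ) : Multiset (OnePoint ℂ) :=
  zeros d (sectionY d f y)

/-- `f` is a map of `d`-tuples. -/
structure IsMapOfTuples (d : ℕ) (f : ℂ[X][Y]) : Prop extends IsCorrespondence d f where
  preimage_eq : ∀ x : OnePoint ℂ, ∀ y ∈ image d f x, ∀ y' ∈ image d f x,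
    preimage d f y = preimage d f y'
  image_eq : ∀ y : OnePoint ℂ, ∀ x ∈ preimage d f y, ∀ x' ∈ preimage d f y,
    image d f x = image d f x'

/-- `f = g ^ (d / k)` for a proper divisor `k` of `d` and a map `g` of `k`-tuples. -/
def IsProperPower (d : ℕ) (f : ℂ[X][Y]) : Prop :=
  ∃ (k : ℕ) (g : ℂ[X][Y]), k ∣ d ∧ k ≠ d ∧ IsMapOfTuples k g ∧ f = g ^ (d / k)

/-- The fraction `P / Q` is a rational function of degree `d`. -/
def IsFractionOfDegree (d : ℕ) (P Q : ℂ[X]) : Prop :=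
  IsCoprime P Q ∧ max P.natDegree Q.natDegree = d

/-- The self-map of the sphere given by the fraction `P / Q` of degree `d`. -/
def fracMap (d : ℕ) (P Q : ℂ[X]) (x : OnePoint ℂ) : OnePoint ℂ :=
  open Classical in
  if formEval d Q x = 0 then OnePoint.infty
  else ((formEval d P x / formEval d Q x : ℂ) : OnePoint ℂ)

/-- The equation `f (x, y) = 0` can be rewritten, on the product of spheres, as `Φ x = Ψ y` with
`Φ = K / L` and `Ψ = M / N` fractions of degree `d`. -/
def IsSeparation (d : ℕ) (f : ℂ[X][Y]) (K L M N : ℂ[X]) : Prop :=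
  IsFractionOfDegree d K L ∧ IsFractionOfDegree d M N ∧
    ∀ x y : OnePoint ℂ, (x, y) ∈ completion d f ↔ fracMap d K L x = fracMap d M N y

/-- All coefficients of `p` are real. -/
def HasRealCoeffs (p : ℂ[X]) : Prop := ∀ i, (p.coeff i).im = 0

end TupleMap

end

/- All irreducible factors of a map of `d`-tuples occur with the same multiplicity, because this
multiplicity can be read off the fibres over a generic point, and those coincide. So `f` is a power
of a squarefree polynomial, which is again a map of tuples; if `f` is not a proper power, it is
squarefree. By the Nullstellensatz a polynomial of the same bidegree vanishing on the curve `f = 0`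
is then a multiple of `f`; when the curve is invariant under conjugation this applies to the
conjugate of `f`, so `f` is real up to a constant.

For squarefree `f`, two generic vertical sections `M = f (x₁, ·)` and `N = f (x₂, ·)` have simple
and disjoint zeros, and interpolation at these zeros gives `f = K(x) N(y) - L(x) M(y)`. If `f` is
real and `x₁`, `x₂` are taken real, then `M`, `N` are real, and so are `K`, `L` because `M` and `N`
are linearly independent. -/

namespace TupleMap

open Polynomial Filter ComplexConjugate

theorem isCoprime_map_algebraMap {R : Type*} [CommRing R] [IsDomain R]
    [UniqueFactorizationMonoid R] (K : Type*) [Field K] [Algebra R K] [IsFractionRing R K]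
    {f g : R[X]} (hf : f.IsPrimitive) (h : IsRelPrime f g) :
    IsCoprime (f.map (algebraMap R K)) (g.map (algebraMap R K)) := by
  induction f using UniqueFactorizationMonoid.induction_on_prime with
  | h₁ => exact absurd rfl hf.ne_zero
  | h₂ u hu =>
    exact (isCoprime_one_left.of_isCoprime_of_dvd_left
      (hu.map (mapRingHom (algebraMap R K))).dvd)
  | h₃ a p _ hp ih =>
    have hpp : p.IsPrimitive := isPrimitive_of_dvd hf (dvd_mul_right p a)
    rw [Polynomial.map_mul]
    refine IsCoprime.mul_left ?_ (ih (isPrimitive_of_dvd hf (dvd_mul_left a p))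
      h.of_mul_left_right)
    have hirr := (hpp.irreducible_iff_irreducible_map_fraction_map (K := K)).1 hp.irreducible
    exact hirr.coprime_iff_not_dvd.2 fun hd => hp.not_isUnit
      (h (dvd_mul_right p a) (hpp.dvd_of_fraction_map_dvd_fraction_map hd))

theorem resultant_ne_zero_of_isRelPrime {R : Type*} [CommRing R] [IsDomain R]
    [UniqueFactorizationMonoid R] {f g : R[X]} (hf : f.IsPrimitive) (h : IsRelPrime f g) :
    resultant f g ≠ 0 := fun h0 => by
  have hinj := IsFractionRing.injective R (FractionRing R)
  have h0' := congrArg (algebraMap R (FractionRing R)) h0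
  rw [map_zero, ← resultant_map_map, ← natDegree_map_eq_of_injective hinj f,
    ← natDegree_map_eq_of_injective hinj g, resultant_eq_zero_iff] at h0'
  exact h0'.2 (isCoprime_map_algebraMap _ hf h)

theorem natDegree_pos_of_dvd_isPrimitive {R : Type*} [CommSemiring R] {f p : R[X]}
    (hf : f.IsPrimitive) (hp : ¬ IsUnit p) (h : p ∣ f) : 0 < p.natDegree := by
  by_contra! h0
  rw [eq_C_of_natDegree_le_zero h0] at h hp
  exact hp ((hf _ h).map C)

theorem isRelPrime_derivative {R : Type*} [CommRing R] [IsDomain R] [CharZero R]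
    [UniqueFactorizationMonoid R] {f : R[X]} (hf : f.IsPrimitive) (hs : Squarefree f) :
    IsRelPrime f (derivative f) := by
  refine WfDvdMonoid.isRelPrime_of_no_irreducible_factors (fun h => hf.ne_zero h.1) ?_
  rintro p hp ⟨s, rfl⟩ hd
  have hpos := natDegree_pos_of_dvd_isPrimitive hf hp.not_isUnit (dvd_mul_right p s)
  rw [derivative_mul, dvd_add_left (dvd_mul_right p _)] at hd
  rcases hp.prime.dvd_or_dvd hd with h | h
  · exact hpos.ne' (derivative_eq_zero.1 (eq_zero_of_dvd_of_natDegree_lt h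
      (natDegree_derivative_lt hpos.ne')))
  · exact hp.not_isUnit (hs p (mul_dvd_mul_left p h))

theorem eventually_eval_ne_zero {R : Type*} [CommRing R] [IsDomain R] {r : R[X]} (hr : r ≠ 0) :
    ∀ᶠ x in cofinite, r.eval x ≠ 0 := by
  simpa only [eventually_cofinite, not_not, ← IsRoot.def] using finite_setOfPred_isRoot hr

theorem eventually_natDegree_map_evalRingHom {R : Type*} [CommRing R] [IsDomain R] (f : R[X][Y]) :
    ∀ᶠ x in cofinite, (f.map (evalRingHom x)).natDegree = f.natDegree := by
  rcases eq_or_ne f 0 with rfl | hf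
  · simp
  filter_upwards [eventually_eval_ne_zero (leadingCoeff_ne_zero.2 hf)] with x hx
  exact natDegree_map_of_leadingCoeff_ne_zero _ hx

section Specialization

variable {K : Type*} [Field K]

theorem eventually_isCoprime_map_evalRingHom {f g : K[X][Y]} (hf : f.IsPrimitive)
    (h : IsRelPrime f g) :
    ∀ᶠ x in cofinite, IsCoprime (f.map (evalRingHom x)) (g.map (evalRingHom x)) := by
  filter_upwards [eventually_eval_ne_zero (resultant_ne_zero_of_isRelPrime hf h),
    eventually_natDegree_map_evalRingHom f, eventually_natDegree_map_evalRingHom g,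
    eventually_eval_ne_zero (leadingCoeff_ne_zero.2 hf.ne_zero)] with x hx hfx hgx hlc
  have hfx0 : f.map (evalRingHom x) ≠ 0 :=
    fun h0 => hlc (by simpa using congrArg (coeff · f.natDegree) h0)
  rw [← coe_evalRingHom, ← resultant_map_map, ← hfx, ← hgx, Ne, resultant_eq_zero_iff] at hx
  exact not_not.1 fun hco => hx ⟨.inl hfx0, hco⟩

theorem eventually_separable_map_evalRingHom [CharZero K] {f : K[X][Y]} (hf : f.IsPrimitive)
    (hs : Squarefree f) : ∀ᶠ x in cofinite, (f.map (evalRingHom x)).Separable := by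
  filter_upwards [eventually_isCoprime_map_evalRingHom hf (isRelPrime_derivative hf hs)] with x hx
  rwa [Separable, derivative_map]

theorem exists_evalEval_eq_zero [IsAlgClosed K] {f : K[X][Y]} {x : K}
    (h : (f.map (evalRingHom x)).natDegree ≠ 0) : ∃ y, f.evalEval x y = 0 := by
  simpa only [IsRoot.def, map_evalRingHom_eval] using
    IsAlgClosed.exists_root (f.map (evalRingHom x)) fun h0 => h (natDegree_eq_of_degree_eq_some h0)

theorem eventually_exists_evalEval_eq_zero [IsAlgClosed K] {f : K[X][Y]} (hf : f.natDegree ≠ 0) :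
    ∀ᶠ x in cofinite, ∃ y, f.evalEval x y = 0 :=
  (eventually_natDegree_map_evalRingHom f).mono fun _ hx => exists_evalEval_eq_zero (hx ▸ hf)

theorem eventually_rootMultiplicity_map_evalRingHom [CharZero K] {f p : K[X][Y]}
    (hf : f ≠ 0) (hp : Irreducible p) (hpp : p.IsPrimitive) :
    ∀ᶠ x in cofinite, ∀ y, p.evalEval x y = 0 →
      (f.map (evalRingHom x)).rootMultiplicity y = multiplicity p f := by
  obtain ⟨q, hfq, hq⟩ :=
    (FiniteMultiplicity.of_prime_left hp.prime hf).exists_eq_pow_mul_and_not_dvd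
  filter_upwards [eventually_separable_map_evalRingHom hpp hp.squarefree,
    eventually_isCoprime_map_evalRingHom hpp (hp.dvd_or_isRelPrime.resolve_left hq)]
    with x hsep hcop y hy
  rw [← map_evalRingHom_eval] at hy
  have hqy : (q.map (evalRingHom x)).eval y ≠ 0 := fun hqy => by
    obtain ⟨u, v, huv⟩ := hcop
    simpa [hy, hqy] using congrArg (eval y) huv
  have hp1 : (p.map (evalRingHom x)).rootMultiplicity y = 1 :=
    (rootMultiplicity_le_one_of_separable hsep y).antisymm
      ((rootMultiplicity_pos hsep.ne_zero).2 hy)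
  have hq0 : q.map (evalRingHom x) ≠ 0 := fun h0 => hqy (by rw [h0, eval_zero])
  classical
  conv_lhs => rw [hfq, Polynomial.map_mul, Polynomial.map_pow]
  rw [rootMultiplicity_mul (mul_ne_zero (pow_ne_zero _ hsep.ne_zero) hq0), ← count_roots,
    roots_pow, Multiset.count_nsmul, count_roots, hp1, rootMultiplicity_eq_zero hqy, mul_one,
    add_zero]

theorem dvd_of_forall_evalEval_eq_zero [IsAlgClosed K] {f g : K[X][Y]} (hf : Squarefree f)
    (h : ∀ x y, f.evalEval x y = 0 → g.evalEval x y = 0) : f ∣ g := by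
  let e := Bivariate.equivMvPolynomial K
  have he (p : K[X][Y]) (v : Fin 2 → K) : MvPolynomial.aeval v (e p) = p.evalEval (v 0) (v 1) := by
    rw [← coe_aevalAeval_eq_evalEval]
    refine DFunLike.congr_fun (?_ : (MvPolynomial.aeval v).comp e.toAlgHom =
      aevalAeval (v 0) (v 1)) p
    ext <;> simp [e]
  have hmem : e g ∈ (Ideal.span {e f}).radical := by
    rw [← MvPolynomial.vanishingIdeal_zeroLocus_eq_radical (K := K)]
    intro v hv
    have := hv (e f) (Ideal.mem_span_singleton_self _)
    rw [he] at this ⊢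
    exact h _ _ this
  obtain ⟨n, hn⟩ := hmem
  rw [Ideal.mem_span_singleton, ← map_pow, map_dvd_iff] at hn
  exact hf.isRadical n g hn

end Specialization

theorem coeff_coeff_swap {R : Type*} [CommSemiring R] (f : R[X][Y]) (i j : ℕ) :
    ((Bivariate.swap f).coeff i).coeff j = (f.coeff j).coeff i := by
  induction f using Polynomial.induction_on' with
  | add p q hp hq => simp only [map_add, coeff_add, hp, hq]
  | monomial n a =>
    induction a using Polynomial.induction_on' with
    | add p q hp hq => simp only [map_add, coeff_add, hp, hq]
    | monomial m r =>
      rw [Bivariate.swap_monomial_monomial]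
      simp only [coeff_monomial]
      split_ifs <;> simp_all only [coeff_monomial, if_true, if_false, coeff_zero]

theorem evalEval_swap {R : Type*} [CommSemiring R] (f : R[X][Y]) (x y : R) :
    (Bivariate.swap f).evalEval x y = f.evalEval y x := by
  simpa only [coe_aevalAeval_eq_evalEval] using Bivariate.aevalAeval_swap x y f

theorem natDegree_swap_le_iff {R : Type*} [CommSemiring R] {d : ℕ} {f : R[X][Y]} :
    (Bivariate.swap f).natDegree ≤ d ↔ ∀ j, (f.coeff j).natDegree ≤ d := by
  simp only [natDegree_le_iff_coeff_eq_zero, Polynomial.ext_iff, coeff_coeff_swap, coeff_zero]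
  exact ⟨fun h j i hi => h i hi j, fun h i hi j => h j i hi⟩

theorem sectionY_swap {d : ℕ} {f : ℂ[X][Y]} (h : f.natDegree ≤ d) (a : OnePoint ℂ) :
    sectionY d (Bivariate.swap f) a = sectionX d f a := by
  cases a with
  | infty =>
    refine ((as_sum_range' _ (d + 1) (Nat.lt_succ_of_le ?_)).trans ?_ :
      (Bivariate.swap f).coeff d = _)
    · exact natDegree_swap_le_iff.1 (by rwa [Bivariate.swap_swap_apply]) d
    · simp only [sectionX, coeff_coeff_swap, C_mul_X_pow_eq_monomial]
  | coe a =>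
    refine Polynomial.funext fun y => ?_
    exact (evalEval_swap f y a).trans (map_evalRingHom_eval a y f).symm

theorem sectionX_swap {d : ℕ} {f : ℂ[X][Y]} (h : ∀ j, (f.coeff j).natDegree ≤ d)
    (b : OnePoint ℂ) : sectionX d (Bivariate.swap f) b = sectionY d f b := by
  rw [← sectionY_swap (natDegree_swap_le_iff.2 h), Bivariate.swap_swap_apply]

theorem eval_sectionX_coe (d : ℕ) (f : ℂ[X][Y]) (x y : ℂ) :
    (sectionX d f x).eval y = f.evalEval x y :=
  map_evalRingHom_eval x y f

theorem eval_sectionY_coe (d : ℕ) (f : ℂ[X][Y]) (x y : ℂ) :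
    (sectionY d f y).eval x = f.evalEval x y :=
  rfl

theorem natDegree_sectionX_coe_le {d : ℕ} {f : ℂ[X][Y]} (h : f.natDegree ≤ d) (x : ℂ) :
    (sectionX d f x).natDegree ≤ d :=
  natDegree_map_le.trans h

theorem natDegree_sectionY_coe_le {d : ℕ} {f : ℂ[X][Y]} (h : ∀ j, (f.coeff j).natDegree ≤ d)
    (y : ℂ) : (sectionY d f y).natDegree ≤ d := by
  rw [← sectionX_swap h]
  exact natDegree_sectionX_coe_le (natDegree_swap_le_iff.2 h) y

namespace IsCorrespondence

variable {d : ℕ} {f : ℂ[X][Y]}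

protected theorem swap (hf : IsCorrespondence d f) : IsCorrespondence d (Bivariate.swap f) where
  natDegree_y_le := natDegree_swap_le_iff.2 hf.natDegree_x_le
  natDegree_x_le := natDegree_swap_le_iff.1 (by
    rw [Bivariate.swap_swap_apply]
    exact hf.natDegree_y_le)
  sectionX_ne_zero a := by
    rw [sectionX_swap hf.natDegree_x_le]
    exact hf.sectionY_ne_zero a
  sectionY_ne_zero a := by
    rw [sectionY_swap hf.natDegree_y_le]
    exact hf.sectionX_ne_zero a

theorem natDegree_eq (hf : IsCorrespondence d f) : f.natDegree = d :=
  hf.natDegree_y_le.antisymm (le_natDegree_of_ne_zero (hf.sectionY_ne_zero none))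

protected theorem ne_zero (hf : IsCorrespondence d f) : f ≠ 0 := by
  rintro rfl
  exact hf.sectionY_ne_zero none rfl

protected theorem isPrimitive (hf : IsCorrespondence d f) : f.IsPrimitive := by
  rintro r ⟨s, rfl⟩
  by_contra hr
  obtain ⟨a, ha⟩ := IsAlgClosed.exists_root r fun h => hr (isUnit_iff_degree_eq_zero.2 h)
  refine hf.sectionX_ne_zero a ?_
  change (C r * s).map (evalRingHom a) = 0
  rw [Polynomial.map_mul, map_C, coe_evalRingHom, ha.eq_zero, C_0, zero_mul]

end IsCorrespondence

theorem count_coe_zeros [DecidableEq (OnePoint ℂ)] (d : ℕ) (p : ℂ[X]) (a : ℂ) :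
    (zeros d p).count (a : OnePoint ℂ) = p.rootMultiplicity a := by
  rw [zeros, Multiset.count_add, Multiset.count_replicate,
    Multiset.count_map_eq_count' _ _ OnePoint.coe_injective, count_roots,
    if_neg (OnePoint.infty_ne_coe a), add_zero]

theorem coe_mem_zeros {d : ℕ} {p : ℂ[X]} (hp : p ≠ 0) {a : ℂ} :
    (a : OnePoint ℂ) ∈ zeros d p ↔ p.eval a = 0 := by
  classical
  rw [← Multiset.count_pos, count_coe_zeros, rootMultiplicity_pos hp, IsRoot.def]

theorem exists_eq_C_mul_of_zeros_eq {d : ℕ} {p q : ℂ[X]} (hp : p ≠ 0) (hq : q ≠ 0)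
    (h : zeros d p = zeros d q) : ∃ c : ℂ, q = C c * p := by
  classical
  have hr : p.roots = q.roots := by
    ext a
    rw [count_roots, count_roots, ← count_coe_zeros d, ← count_coe_zeros d, h]
  obtain ⟨u, rfl⟩ := (IsAlgClosed.associated_iff_roots_eq_roots hp hq).2 hr
  obtain ⟨c, -, hc⟩ := isUnit_iff.1 u.isUnit
  exact ⟨c, by rw [hc, mul_comm]⟩

theorem zeros_pow (d m : ℕ) (p : ℂ[X]) : zeros (m * d) (p ^ m) = m • zeros d p := by
  simp only [zeros, roots_pow, natDegree_pow, nsmul_add, Multiset.map_nsmul, ← Nat.mul_sub,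
    Multiset.nsmul_replicate]

theorem IsCorrespondence.coe_mem_image {d : ℕ} {f : ℂ[X][Y]} (hf : IsCorrespondence d f)
    {x y : ℂ} : (y : OnePoint ℂ) ∈ image d f x ↔ f.evalEval x y = 0 := by
  rw [image, coe_mem_zeros (hf.sectionX_ne_zero x), eval_sectionX_coe]

theorem IsCorrespondence.coe_mem_preimage {d : ℕ} {f : ℂ[X][Y]} (hf : IsCorrespondence d f)
    {x y : ℂ} : (x : OnePoint ℂ) ∈ preimage d f y ↔ f.evalEval x y = 0 := by
  rw [preimage, coe_mem_zeros (hf.sectionY_ne_zero y), eval_sectionY_coe]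

theorem associated_radical_pow {M : Type*} [CommMonoidWithZero M] [NormalizationMonoid M]
    [UniqueFactorizationMonoid M] {f : M} (hf : f ≠ 0) {m : ℕ}
    (h : ∀ p, Irreducible p → p ∣ f → multiplicity p f = m) :
    Associated (UniqueFactorizationMonoid.radical f ^ m) f := by
  classical
  refine .trans (.of_eq ?_) (UniqueFactorizationMonoid.prod_normalizedFactors hf)
  rw [UniqueFactorizationMonoid.radical, ← Finset.prod_pow, Finset.prod_multiset_count,
    UniqueFactorizationMonoid.primeFactors]
  refine Finset.prod_congr (by congr) fun p hp => ?_
  have hp' := Multiset.mem_toFinset.1 hp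
  have hirr := UniqueFactorizationMonoid.irreducible_of_normalized_factor p hp'
  rw [← h p hirr (UniqueFactorizationMonoid.dvd_of_mem_normalizedFactors hp'),
    UniqueFactorizationMonoid.multiplicity_eq_count_normalizedFactors hirr hf,
    UniqueFactorizationMonoid.normalize_normalized_factor p hp', id]

theorem exists_pow_eq_of_associated {K : Type*} [Field K] [IsAlgClosed K] {m : ℕ} (hm : m ≠ 0)
    {f g : K[X][Y]} (h : Associated (g ^ m) f) : ∃ g', Associated g g' ∧ f = g' ^ m := by
  obtain ⟨u, rfl⟩ := h
  obtain ⟨r, hr, hru⟩ := isUnit_iff.1 u.isUnit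
  obtain ⟨c, hc, rfl⟩ := isUnit_iff.1 hr
  obtain ⟨z, rfl⟩ := IsAlgClosed.exists_pow_nat_eq c (Nat.pos_of_ne_zero hm)
  have hz : IsUnit (C (C z)) := (((isUnit_pow_iff hm).1 hc).map C).map C
  exact ⟨g * C (C z), associated_mul_unit_right g _ hz, by rw [mul_pow, ← C_pow, ← C_pow, hru]⟩

theorem sectionY_pow {d : ℕ} {f : ℂ[X][Y]} (h : f.natDegree ≤ d) (m : ℕ) (b : OnePoint ℂ) :
    sectionY (m * d) (f ^ m) b = sectionY d f b ^ m := by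
  cases b with
  | infty => exact coeff_pow_of_natDegree_le h
  | coe b => exact eval_pow m

theorem sectionX_pow {d : ℕ} {f : ℂ[X][Y]} (hy : f.natDegree ≤ d)
    (hx : ∀ j, (f.coeff j).natDegree ≤ d) (m : ℕ) (a : OnePoint ℂ) :
    sectionX (m * d) (f ^ m) a = sectionX d f a ^ m := by
  rw [← sectionY_swap (natDegree_pow_le_of_le m hy), map_pow,
    sectionY_pow (natDegree_swap_le_iff.2 hx), sectionY_swap hy]

theorem IsCorrespondence.of_pow {d m : ℕ} (hm : m ≠ 0) {f : ℂ[X][Y]}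
    (hf : IsCorrespondence (m * d) (f ^ m)) : IsCorrespondence d f := by
  have hy : f.natDegree ≤ d := by
    have := hf.natDegree_y_le
    rw [natDegree_pow] at this
    exact Nat.le_of_mul_le_mul_left this (Nat.pos_of_ne_zero hm)
  have hx : ∀ j, (f.coeff j).natDegree ≤ d := natDegree_swap_le_iff.1 <| by
    have := hf.swap.natDegree_y_le
    rw [map_pow, natDegree_pow] at this
    exact Nat.le_of_mul_le_mul_left this (Nat.pos_of_ne_zero hm)
  refine ⟨hy, hx, fun a h0 => hf.sectionX_ne_zero a ?_, fun b h0 => hf.sectionY_ne_zero b ?_⟩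
  · rw [sectionX_pow hy hx, h0, zero_pow hm]
  · rw [sectionY_pow hy, h0, zero_pow hm]

theorem IsMapOfTuples.of_pow {d m : ℕ} (hm : m ≠ 0) {f : ℂ[X][Y]}
    (hf : IsMapOfTuples (m * d) (f ^ m)) : IsMapOfTuples d f := by
  have hcor := hf.toIsCorrespondence.of_pow hm
  have him (x : OnePoint ℂ) : image (m * d) (f ^ m) x = m • image d f x := by
    rw [image, sectionX_pow hcor.natDegree_y_le hcor.natDegree_x_le, zeros_pow, image]
  have hpre (y : OnePoint ℂ) : preimage (m * d) (f ^ m) y = m • preimage d f y := by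
    rw [preimage, sectionY_pow hcor.natDegree_y_le, zeros_pow, preimage]
  refine ⟨hcor, fun x y hy y' hy' => nsmul_right_injective hm ?_,
    fun y x hx x' hx' => nsmul_right_injective hm ?_⟩
  · have := hf.preimage_eq x y (by simpa [him, hm] using hy) y' (by simpa [him, hm] using hy')
    rwa [hpre, hpre] at this
  · have := hf.image_eq y x (by simpa [hpre, hm] using hx) x' (by simpa [hpre, hm] using hx')
    rwa [him, him] at this

theorem IsCorrespondence.eventually_forall_of_evalEval_eq_zero {d : ℕ} {f : ℂ[X][Y]}
    (hf : IsCorrespondence d f) {P : ℂ → Prop} (hP : ∀ᶠ x in cofinite, P x) :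
    ∀ᶠ y in cofinite, ∀ x, f.evalEval x y = 0 → P x := by
  have hfin : ∀ᶠ y in cofinite, ∀ x ∈ {x | ¬ P x}, (sectionX d f x).eval y ≠ 0 :=
    (eventually_all_finite hP).2 fun x _ => eventually_eval_ne_zero (hf.sectionX_ne_zero x)
  filter_upwards [hfin] with y hy x hxy
  by_contra hx
  exact hy x hx ((eval_sectionX_coe d f x y).trans hxy)

theorem IsCorrespondence.eventually_exists_of_dvd {d : ℕ} {f p : ℂ[X][Y]}
    (hf : IsCorrespondence d f) (hp : ¬ IsUnit p) (h : p ∣ f) :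
    ∀ᶠ y in cofinite, ∃ x, p.evalEval x y = 0 := by
  have hpos : 0 < (Bivariate.swap p).natDegree :=
    natDegree_pos_of_dvd_isPrimitive hf.swap.isPrimitive
      (mt (MulEquiv.isUnit_map Bivariate.swap).1 hp) (map_dvd_iff (Bivariate.swap (R := ℂ)) |>.2 h)
  simpa only [evalEval_swap] using eventually_exists_evalEval_eq_zero hpos.ne'

theorem IsMapOfTuples.multiplicity_eq {d : ℕ} {f p q : ℂ[X][Y]} (hf : IsMapOfTuples d f)
    (hp : Irreducible p) (hpf : p ∣ f) (hq : Irreducible q) (hqf : q ∣ f) :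
    multiplicity p f = multiplicity q f := by
  -- For generic `y`, pick `x`, `x'` over `y` on the curves `p = 0` and `q = 0`. The multiplicities
  -- in question are those of `y` in the multisets `image x` and `image x'`, which coincide.
  classical
  have hmult {r : ℂ[X][Y]} (hr : Irreducible r) (hrf : r ∣ f) :=
    hf.eventually_forall_of_evalEval_eq_zero (eventually_rootMultiplicity_map_evalRingHom
      hf.ne_zero hr (isPrimitive_of_dvd hf.isPrimitive hrf))
  obtain ⟨y, ⟨x, hx⟩, ⟨x', hx'⟩, hpy, hqy⟩ :=
    ((hf.eventually_exists_of_dvd hp.not_isUnit hpf).and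
      ((hf.eventually_exists_of_dvd hq.not_isUnit hqf).and
        ((hmult hp hpf).and (hmult hq hqf)))).exists
  have hfx : f.evalEval x y = 0 := zero_dvd_iff.1 (hx ▸ evalEval_dvd x y hpf)
  have hfx' : f.evalEval x' y = 0 := zero_dvd_iff.1 (hx' ▸ evalEval_dvd x' y hqf)
  have himage : image d f x = image d f x' :=
    hf.image_eq y x (hf.coe_mem_preimage.2 hfx) x' (hf.coe_mem_preimage.2 hfx')
  have hcount := congrArg (Multiset.count (y : OnePoint ℂ)) himage
  rw [image, image, count_coe_zeros, count_coe_zeros] at hcount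
  exact (hpy x hfx y hx).symm.trans (hcount.trans (hqy x' hfx' y hx'))

theorem IsMapOfTuples.exists_squarefree_pow {d : ℕ} (hd : d ≠ 0) {f : ℂ[X][Y]}
    (hf : IsMapOfTuples d f) : ∃ (m : ℕ) (g : ℂ[X][Y]), m ≠ 0 ∧ Squarefree g ∧ f = g ^ m := by
  have hu : ¬ IsUnit f := fun hu => hd (hf.natDegree_eq.symm.trans (natDegree_eq_zero_of_isUnit hu))
  obtain ⟨p, hp, hpf⟩ := WfDvdMonoid.exists_irreducible_factor hu hf.ne_zero
  have hm : multiplicity p f ≠ 0 := multiplicity_ne_zero.2 hpf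
  obtain ⟨g, hg, hfg⟩ := exists_pow_eq_of_associated hm (associated_radical_pow hf.ne_zero
    fun q hq hqf => hf.multiplicity_eq hq hqf hp hpf)
  exact ⟨_, g, hm, hg.squarefree_iff.1 UniqueFactorizationMonoid.squarefree_radical, hfg⟩

theorem IsMapOfTuples.squarefree {d : ℕ} (hd : d ≠ 0) {f : ℂ[X][Y]} (hf : IsMapOfTuples d f)
    (hpow : ¬ IsProperPower d f) : Squarefree f := by
  obtain ⟨m, g, hm, hg, rfl⟩ := hf.exists_squarefree_pow hd
  have hdeg : d = m * g.natDegree := by rw [← natDegree_pow, hf.natDegree_eq]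
  rw [hdeg] at hd
  rcases eq_or_ne m 1 with rfl | hm1
  · rwa [pow_one]
  refine absurd ⟨g.natDegree, g, hdeg ▸ dvd_mul_left _ m, fun h => hm1 ?_,
    (hdeg ▸ hf).of_pow hm, ?_⟩ hpow
  · exact Nat.eq_of_mul_eq_mul_right (Nat.pos_of_ne_zero (right_ne_zero_of_mul hd))
      (by rw [one_mul, ← hdeg, h])
  · rw [hdeg, Nat.mul_div_cancel _ (Nat.pos_of_ne_zero (right_ne_zero_of_mul hd))]

theorem IsCorrespondence.exists_eq_C_mul {d : ℕ} {f g : ℂ[X][Y]} (hf : IsCorrespondence d f)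
    (hs : Squarefree f) (hy : g.natDegree ≤ d) (hx : ∀ j, (g.coeff j).natDegree ≤ d)
    (h : ∀ x y, f.evalEval x y = 0 → g.evalEval x y = 0) : ∃ c : ℂ, g = C (C c) * f := by
  obtain ⟨q, rfl⟩ := dvd_of_forall_evalEval_eq_zero hs h
  rcases eq_or_ne q 0 with rfl | hq
  · exact ⟨0, by simp⟩
  have hqy : q.natDegree = 0 := by
    rw [natDegree_mul hf.ne_zero hq, hf.natDegree_eq] at hy
    lia
  have hqx : (Bivariate.swap q).natDegree ≤ 0 := by
    have hq' : Bivariate.swap q ≠ 0 := (map_ne_zero_iff _ Bivariate.swap.injective).2 hq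
    replace hx := natDegree_swap_le_iff.2 hx
    rw [map_mul, natDegree_mul hf.swap.ne_zero hq', hf.swap.natDegree_eq] at hx
    lia
  refine ⟨(q.coeff 0).coeff 0, ?_⟩
  rw [mul_comm, ← eq_C_of_natDegree_le_zero (natDegree_swap_le_iff.1 hqx 0),
    ← eq_C_of_natDegree_eq_zero hqy]

/-- The polynomial `K(x) N(y) - L(x) M(y)`, whose vanishing is the equation
`K(x) / L(x) = M(y) / N(y)` cleared of denominators. -/
noncomputable def separated {R : Type*} [CommRing R] (K L M N : R[X]) : R[X][Y] :=
  C K * N.map C - C L * M.map C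

theorem swap_separated {R : Type*} [CommRing R] (K L M N : R[X]) :
    Bivariate.swap (separated K L M N) = separated N M L K := by
  simp only [separated, map_sub, map_mul, Bivariate.swap_C, Bivariate.swap_map_C, mul_comm]

theorem separated_C_mul {R : Type*} [CommRing R] (c : R) (K L M N : R[X]) :
    separated K L (C c * M) (C c * N) = C (C c) * separated K L M N := by
  simp only [separated, Polynomial.map_mul, map_C]
  ring

theorem natDegree_separated_le {R : Type*} [CommRing R] {d : ℕ} (K L : R[X]) {M N : R[X]}
    (hM : M.natDegree ≤ d) (hN : N.natDegree ≤ d) : (separated K L M N).natDegree ≤ d :=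
  (natDegree_sub_le _ _).trans <| max_le
    ((natDegree_C_mul_le _ _).trans (natDegree_map_le.trans hN))
    ((natDegree_C_mul_le _ _).trans (natDegree_map_le.trans hM))

theorem map_evalRingHom_separated {R : Type*} [CommRing R] (K L M N : R[X]) (x : R) :
    (separated K L M N).map (evalRingHom x) = C (K.eval x) * N - C (L.eval x) * M := by
  have hC : (evalRingHom x).comp C = RingHom.id R := by ext; simp
  simp [separated, Polynomial.map_map, hC]

theorem sectionY_separated (d : ℕ) (K L M N : ℂ[X]) (y : OnePoint ℂ) :
    sectionY d (separated K L M N) y = C (formEval d N y) * K - C (formEval d M y) * L := by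
  cases y <;> simp [sectionY, separated, formEval, mul_comm]

theorem sectionX_separated {d : ℕ} (K L : ℂ[X]) {M N : ℂ[X]} (hM : M.natDegree ≤ d)
    (hN : N.natDegree ≤ d) (x : OnePoint ℂ) :
    sectionX d (separated K L M N) x = C (formEval d K x) * N - C (formEval d L x) * M := by
  rw [← sectionY_swap (natDegree_separated_le K L hM hN), swap_separated, sectionY_separated]

theorem linearIndependent_pair_of_isCoprime {F : Type*} [Field F] {P Q : F[X]}
    (h : IsCoprime P Q) (hP : P.natDegree ≠ 0) : LinearIndependent F ![P, Q] := by
  refine (LinearIndependent.pair_iff' (ne_zero_of_natDegree_gt (Nat.pos_of_ne_zero hP))).2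
    fun a ha => hP (natDegree_eq_zero_of_isUnit (h.isUnit_of_dvd' dvd_rfl ?_))
  exact ⟨C a, by rw [← ha, smul_eq_C_mul, mul_comm]⟩

theorem eq_of_separated_eq {F : Type*} [Field F] {K L K' L' M N : F[X]}
    (h : LinearIndependent F ![M, N]) (heq : separated K L M N = separated K' L' M N) :
    K = K' ∧ L = L' := by
  have hcoeff (i : ℕ) : L.coeff i - L'.coeff i = 0 ∧ K'.coeff i - K.coeff i = 0 := by
    refine LinearIndependent.pair_iff.1 h _ _ ?_
    have := congrArg (fun p => (Bivariate.swap p).coeff i) heq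
    simp only [swap_separated] at this
    simp only [separated, coeff_sub, coeff_C_mul, coeff_map] at this
    simp only [smul_eq_C_mul, C_sub]
    linear_combination -this
  exact ⟨Polynomial.ext fun i => (sub_eq_zero.1 (hcoeff i).2).symm,
    Polynomial.ext fun i => sub_eq_zero.1 (hcoeff i).1⟩

theorem dvd_of_separable_of_forall_eval_eq_zero {F : Type*} [Field F] [IsAlgClosed F] {p q : F[X]}
    (hp : p.Separable) (h : ∀ a, p.eval a = 0 → q.eval a = 0) : p ∣ q := by
  rcases eq_or_ne q 0 with rfl | hq
  · exact dvd_zero p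
  rw [IsAlgClosed.dvd_iff_roots_le_roots hp.ne_zero hq, Multiset.le_iff_subset (nodup_roots hp)]
  exact fun a ha => (mem_roots hq).2 (h a (isRoot_of_mem_roots ha))

theorem eq_of_separable_of_forall_eval_eq {F : Type*} [Field F] [IsAlgClosed F] {p q r : F[X]}
    (hr : r.Separable) (hp : p.natDegree < r.natDegree) (hq : q.natDegree < r.natDegree)
    (h : ∀ a, r.eval a = 0 → p.eval a = q.eval a) : p = q :=
  sub_eq_zero.1 <| eq_zero_of_dvd_of_natDegree_lt
    (dvd_of_separable_of_forall_eval_eq_zero hr fun a ha => by rw [eval_sub, h a ha, sub_self])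
    ((natDegree_sub_le p q).trans_lt (max_lt hp hq))

theorem ext_map_evalRingHom {R : Type*} [CommRing R] [IsDomain R] [Infinite R] {f g : R[X][Y]}
    (h : ∀ x, f.map (evalRingHom x) = g.map (evalRingHom x)) : f = g := by
  ext1 n
  exact Polynomial.funext fun x => by simpa using congrArg (coeff · n) (h x)

namespace IsMapOfTuples

variable {d : ℕ} {f : ℂ[X][Y]}

theorem exists_evalEval_eq_mul (hf : IsMapOfTuples d f) {x y y' : ℂ} (h : f.evalEval x y = 0)
    (h' : f.evalEval x y' = 0) : ∃ c : ℂ, ∀ z, f.evalEval z y' = c * f.evalEval z y := by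
  obtain ⟨c, hc⟩ := exists_eq_C_mul_of_zeros_eq (hf.sectionY_ne_zero y) (hf.sectionY_ne_zero y')
    (hf.preimage_eq x y (hf.coe_mem_image.2 h) y' (hf.coe_mem_image.2 h'))
  exact ⟨c, fun z => by rw [← eval_sectionY_coe d, hc, eval_C_mul, eval_sectionY_coe]⟩

theorem isCoprime_sectionX (hf : IsMapOfTuples d f) {x x' y : ℂ} (h : f.evalEval x y = 0)
    (h' : f.evalEval x' y ≠ 0) : IsCoprime (sectionX d f x) (sectionX d f x') := by
  refine (isCoprime_iff_aeval_ne_zero_of_isAlgClosed ℂ ℂ _ _).2 fun z => ?_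
  simp only [coe_aeval_eq_eval, eval_sectionX_coe]
  by_contra! hz
  obtain ⟨c, hc⟩ := hf.exists_evalEval_eq_mul hz.1 h
  exact h' (by rw [hc, hz.2, mul_zero])

theorem exists_eq_separated (hf : IsMapOfTuples d f) (hd : d ≠ 0) {x₁ x₂ : ℂ}
    (hs₁ : (sectionX d f x₁).Separable) (hd₁ : (sectionX d f x₁).natDegree = d)
    (hs₂ : (sectionX d f x₂).Separable) (hd₂ : (sectionX d f x₂).natDegree = d)
    (hco : IsCoprime (sectionX d f x₁) (sectionX d f x₂)) :
    ∃ K L : ℂ[X], K.natDegree ≤ d ∧ L.natDegree ≤ d ∧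
      f = separated K L (sectionX d f x₁) (sectionX d f x₂) := by
  obtain ⟨y₁, hy₁⟩ : ∃ y, f.evalEval x₁ y = 0 := exists_evalEval_eq_zero (hd₁.trans_ne hd)
  obtain ⟨y₂, hy₂⟩ : ∃ y, f.evalEval x₂ y = 0 := exists_evalEval_eq_zero (hd₂.trans_ne hd)
  have hne (y : ℂ) : f.evalEval x₁ y ≠ 0 ∨ f.evalEval x₂ y ≠ 0 := by
    simpa only [coe_aeval_eq_eval, eval_sectionX_coe] using
      (isCoprime_iff_aeval_ne_zero_of_isAlgClosed ℂ ℂ _ _).1 hco y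
  have h₂₁ : f.evalEval x₂ y₁ ≠ 0 := (hne y₁).resolve_left (not_not.2 hy₁)
  have h₁₂ : f.evalEval x₁ y₂ ≠ 0 := (hne y₂).resolve_right (not_not.2 hy₂)
  refine ⟨C (f.evalEval x₂ y₁)⁻¹ * sectionY d f y₁, C (-(f.evalEval x₁ y₂)⁻¹) * sectionY d f y₂,
    (natDegree_C_mul_le _ _).trans (natDegree_sectionY_coe_le hf.natDegree_x_le y₁),
    (natDegree_C_mul_le _ _).trans (natDegree_sectionY_coe_le hf.natDegree_x_le y₂),
    ext_map_evalRingHom fun x => ?_⟩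
  -- At each root `y` of the section over `x₁` (resp. `x₂`), `f (·, y)` is a multiple of `f (·, y₁)`
  -- (resp. `f (·, y₂)`), so both sides agree at the `2 d` roots of the two sections.
  have hdeg : (sectionX d f x₁ * sectionX d f x₂).natDegree = d + d := by
    rw [natDegree_mul hs₁.ne_zero hs₂.ne_zero, hd₁, hd₂]
  have hlt : d < (sectionX d f x₁ * sectionX d f x₂).natDegree := by lia
  refine eq_of_separable_of_forall_eval_eq (hs₁.mul hs₂ hco)
    ((natDegree_sectionX_coe_le hf.natDegree_y_le x).trans_lt hlt)
    ((natDegree_sectionX_coe_le (natDegree_separated_le _ _ hd₁.le hd₂.le) x).trans_lt hlt)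
    fun y hy => ?_
  rw [eval_mul, mul_eq_zero, eval_sectionX_coe, eval_sectionX_coe] at hy
  simp only [map_evalRingHom_separated, map_evalRingHom_eval, eval_sub, eval_mul, eval_C,
    eval_sectionX_coe, eval_sectionY_coe]
  rcases hy with hy | hy
  · obtain ⟨c, hc⟩ := hf.exists_evalEval_eq_mul hy₁ hy
    rw [hc, hc, hc, hy₁]
    field_simp
    ring
  · obtain ⟨c, hc⟩ := hf.exists_evalEval_eq_mul hy₂ hy
    rw [hc, hc, hc, hy₂]
    field_simp
    ring

end IsMapOfTuples

theorem formEval_C_mul (d : ℕ) (c : ℂ) (p : ℂ[X]) (x : OnePoint ℂ) :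
    formEval d (C c * p) x = c * formEval d p x := by
  cases x with
  | infty => exact coeff_C_mul p
  | coe a => exact eval_C_mul

theorem formEval_sub (d : ℕ) (p q : ℂ[X]) (x : OnePoint ℂ) :
    formEval d (p - q) x = formEval d p x - formEval d q x := by
  cases x with
  | infty => exact coeff_sub p q d
  | coe a => exact eval_sub ..

theorem fracMap_eq_fracMap_iff {d : ℕ} {K L M N : ℂ[X]} {x y : OnePoint ℂ}
    (h : formEval d K x ≠ 0 ∨ formEval d L x ≠ 0) (h' : formEval d M y ≠ 0 ∨ formEval d N y ≠ 0) :
    fracMap d K L x = fracMap d M N y ↔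
      formEval d K x * formEval d N y = formEval d L x * formEval d M y := by
  unfold fracMap
  by_cases hL : formEval d L x = 0 <;> by_cases hN : formEval d N y = 0
  · simp [hL, hN]
  · simp_all
  · simp_all
  · rw [if_neg hL, if_neg hN, OnePoint.coe_eq_coe, div_eq_div_iff hL hN, mul_comm (formEval d M y)]

theorem isFractionOfDegree_of_formEval_ne_zero {d : ℕ} {P Q : ℂ[X]} (hP : P.natDegree ≤ d)
    (hQ : Q.natDegree ≤ d) (h : ∀ x, formEval d P x ≠ 0 ∨ formEval d Q x ≠ 0) :
    IsFractionOfDegree d P Q := by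
  refine ⟨(isCoprime_iff_aeval_ne_zero_of_isAlgClosed ℂ ℂ P Q).2 fun a => h a,
    (max_le hP hQ).antisymm ?_⟩
  rcases h none with h0 | h0
  · exact (le_natDegree_of_ne_zero h0).trans (le_max_left _ _)
  · exact (le_natDegree_of_ne_zero h0).trans (le_max_right _ _)

theorem IsFractionOfDegree.formEval_coe_ne_zero {d : ℕ} {P Q : ℂ[X]}
    (h : IsFractionOfDegree d P Q) (a : ℂ) : formEval d P a ≠ 0 ∨ formEval d Q a ≠ 0 :=
  (isCoprime_iff_aeval_ne_zero_of_isAlgClosed ℂ ℂ P Q).1 h.1 a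

theorem IsCorrespondence.isSeparation {d : ℕ} {K L M N : ℂ[X]} (hK : K.natDegree ≤ d)
    (hL : L.natDegree ≤ d) (hM : M.natDegree ≤ d) (hN : N.natDegree ≤ d)
    (hf : IsCorrespondence d (separated K L M N)) :
    IsSeparation d (separated K L M N) K L M N := by
  have hKL (x : OnePoint ℂ) : formEval d K x ≠ 0 ∨ formEval d L x ≠ 0 := by
    by_contra! h
    exact hf.sectionX_ne_zero x (by simp [sectionX_separated K L hM hN, h])
  have hMN (y : OnePoint ℂ) : formEval d M y ≠ 0 ∨ formEval d N y ≠ 0 := by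
    by_contra! h
    exact hf.sectionY_ne_zero y (by simp [sectionY_separated, h])
  refine ⟨isFractionOfDegree_of_formEval_ne_zero hK hL hKL,
    isFractionOfDegree_of_formEval_ne_zero hM hN hMN, fun x y => ?_⟩
  rw [fracMap_eq_fracMap_iff (hKL x) (hMN y), completion, Set.mem_ofPred_eq,
    sectionX_separated K L hM hN, formEval_sub, formEval_C_mul, formEval_C_mul, sub_eq_zero]

theorem isFractionOfDegree_C_mul_iff {d : ℕ} {P Q : ℂ[X]} {c : ℂ} (hc : c ≠ 0) :
    IsFractionOfDegree d (C c * P) (C c * Q) ↔ IsFractionOfDegree d P Q := by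
  rw [IsFractionOfDegree, isCoprime_mul_unit_left ((isUnit_iff_ne_zero.2 hc).map C),
    natDegree_C_mul hc, natDegree_C_mul hc, IsFractionOfDegree]

theorem fracMap_C_mul {d : ℕ} {P Q : ℂ[X]} {c : ℂ} (hc : c ≠ 0) :
    fracMap d (C c * P) (C c * Q) = fracMap d P Q := by
  ext1 x
  simp only [fracMap, formEval_C_mul, mul_eq_zero, hc, false_or, mul_div_mul_left _ _ hc]

theorem isSeparation_C_mul_iff {d : ℕ} {f : ℂ[X][Y]} {K L M N : ℂ[X]} {c : ℂ} (hc : c ≠ 0) :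
    IsSeparation d f K L (C c * M) (C c * N) ↔ IsSeparation d f K L M N := by
  rw [IsSeparation, isFractionOfDegree_C_mul_iff hc, fracMap_C_mul hc, IsSeparation]

theorem IsSeparation.evalEval_eq_zero_iff {d : ℕ} {f : ℂ[X][Y]} {K L M N : ℂ[X]}
    (h : IsSeparation d f K L M N) (x y : ℂ) :
    f.evalEval x y = 0 ↔ K.eval x * N.eval y = L.eval x * M.eval y := by
  rw [← eval_sectionX_coe d]
  exact (h.2.2 x y).trans
    (fracMap_eq_fracMap_iff (h.1.formEval_coe_ne_zero x) (h.2.1.formEval_coe_ne_zero y))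

theorem hasRealCoeffs_iff_map_conj_eq {p : ℂ[X]} :
    HasRealCoeffs p ↔ p.map (starRingEnd ℂ) = p := by
  simp only [HasRealCoeffs, Polynomial.ext_iff, coeff_map, Complex.conj_eq_iff_im]

theorem HasRealCoeffs.eval_conj {p : ℂ[X]} (hp : HasRealCoeffs p) (x : ℂ) :
    p.eval (conj x) = conj (p.eval x) := by
  conv_lhs => rw [← hasRealCoeffs_iff_map_conj_eq.1 hp]
  exact eval_map_apply ..

theorem IsSeparation.evalEval_conj_eq_zero_iff {d : ℕ} {f : ℂ[X][Y]} {K L M N : ℂ[X]}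
    (h : IsSeparation d f K L M N) (hK : HasRealCoeffs K) (hL : HasRealCoeffs L)
    (hM : HasRealCoeffs M) (hN : HasRealCoeffs N) (x y : ℂ) :
    f.evalEval x y = 0 ↔ f.evalEval (conj x) (conj y) = 0 := by
  rw [h.evalEval_eq_zero_iff, h.evalEval_eq_zero_iff, hK.eval_conj, hL.eval_conj, hM.eval_conj,
    hN.eval_conj, ← map_mul, ← map_mul, (starRingEnd ℂ).injective.eq_iff]

/-- The polynomial in two variables whose coefficients are the complex conjugates of those
of `f`; thus `f` is real when `conjCoeffs f = f`. -/
noncomputable def conjCoeffs (f : ℂ[X][Y]) : ℂ[X][Y] :=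
  f.map (mapRingHom (starRingEnd ℂ))

theorem coeff_coeff_conjCoeffs (f : ℂ[X][Y]) (i j : ℕ) :
    ((conjCoeffs f).coeff j).coeff i = conj ((f.coeff j).coeff i) := by
  rw [conjCoeffs, coeff_map, coe_mapRingHom, coeff_map]

theorem evalEval_conjCoeffs (f : ℂ[X][Y]) (x y : ℂ) :
    (conjCoeffs f).evalEval x y = conj (f.evalEval (conj x) (conj y)) := by
  rw [conjCoeffs, ← map_mapRingHom_evalEval, Complex.conj_conj, Complex.conj_conj]

theorem conjCoeffs_C_mul (c : ℂ) (f : ℂ[X][Y]) :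
    conjCoeffs (C (C c) * f) = C (C (conj c)) * conjCoeffs f := by
  simp only [conjCoeffs, Polynomial.map_mul, map_C, coe_mapRingHom]

theorem conjCoeffs_separated (K L M N : ℂ[X]) :
    conjCoeffs (separated K L M N) = separated (K.map (starRingEnd ℂ)) (L.map (starRingEnd ℂ))
      (M.map (starRingEnd ℂ)) (N.map (starRingEnd ℂ)) := by
  have hC : (mapRingHom (starRingEnd ℂ)).comp C = C.comp (starRingEnd ℂ) := by
    ext; simp
  simp only [conjCoeffs, separated, Polynomial.map_sub, Polynomial.map_mul, map_C, coe_mapRingHom,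
    Polynomial.map_map, hC]

theorem hasRealCoeffs_sectionX_ofReal (d : ℕ) {g : ℂ[X][Y]} (hg : conjCoeffs g = g) (x : ℝ) :
    HasRealCoeffs (sectionX d g (x : ℂ)) := by
  have hcomp : (starRingEnd ℂ).comp (evalRingHom (x : ℂ)) =
      (evalRingHom (x : ℂ)).comp (mapRingHom (starRingEnd ℂ)) := by
    ext <;> simp
  rw [hasRealCoeffs_iff_map_conj_eq]
  calc (g.map (evalRingHom (x : ℂ))).map (starRingEnd ℂ)
    _ = (conjCoeffs g).map (evalRingHom (x : ℂ)) := by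
      rw [conjCoeffs, Polynomial.map_map, Polynomial.map_map, hcomp]
    _ = g.map (evalRingHom (x : ℂ)) := by rw [hg]

theorem sectionX_C_mul_coe (d : ℕ) (c : ℂ) (f : ℂ[X][Y]) (x : ℂ) :
    sectionX d (C (C c) * f) x = C c * sectionX d f x := by
  simp only [sectionX, Polynomial.map_mul, map_C, coe_evalRingHom, eval_C]

theorem conjCoeffs_eq_self_iff_exists_coeffMatrix_eq {d : ℕ} {g : ℂ[X][Y]} (hy : g.natDegree ≤ d)
    (hx : ∀ j, (g.coeff j).natDegree ≤ d) :
    conjCoeffs g = g ↔ ∃ B : Matrix (Fin (d + 1)) (Fin (d + 1)) ℝ,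
      coeffMatrix d g = B.map (fun r : ℝ => (r : ℂ)) := by
  constructor
  · intro h
    refine ⟨(coeffMatrix d g).map Complex.re, ?_⟩
    ext i j
    exact (Complex.conj_eq_iff_re.1 (by rw [coeffMatrix, ← coeff_coeff_conjCoeffs, h])).symm
  · rintro ⟨B, hB⟩
    ext j i
    rw [coeff_coeff_conjCoeffs]
    rcases lt_or_ge d j with hj | hj
    · rw [coeff_eq_zero_of_natDegree_lt (hy.trans_lt hj), coeff_zero, map_zero]
    rcases lt_or_ge d i with hi | hi
    · rw [coeff_eq_zero_of_natDegree_lt ((hx j).trans_lt hi), map_zero]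
    have := congrFun₂ hB ⟨d - i, by lia⟩ ⟨d - j, by lia⟩
    simp only [coeffMatrix, Nat.sub_sub_self hi, Nat.sub_sub_self hj, Matrix.map_apply] at this
    rw [this, Complex.conj_ofReal]

theorem coeffMatrix_C_mul (d : ℕ) (c : ℂ) (f : ℂ[X][Y]) :
    coeffMatrix d (C (C c) * f) = c • coeffMatrix d f := by
  ext i j
  simp only [coeffMatrix, coeff_C_mul, Matrix.smul_apply, smul_eq_mul]

theorem exists_coeffMatrix_eq_smul_iff {d : ℕ} {f : ℂ[X][Y]} (hy : f.natDegree ≤ d)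
    (hx : ∀ j, (f.coeff j).natDegree ≤ d) :
    (∃ (c : ℂ) (B : Matrix (Fin (d + 1)) (Fin (d + 1)) ℝ), c ≠ 0 ∧
      coeffMatrix d f = c • B.map (fun r : ℝ => (r : ℂ))) ↔
    ∃ c : ℂ, c ≠ 0 ∧ conjCoeffs (C (C c) * f) = C (C c) * f := by
  have hiff (c : ℂ) := conjCoeffs_eq_self_iff_exists_coeffMatrix_eq
    (g := C (C c) * f) (d := d) ((natDegree_C_mul_le _ _).trans hy) fun j => by
      rw [coeff_C_mul]
      exact (natDegree_C_mul_le _ _).trans (hx j)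
  simp only [hiff, coeffMatrix_C_mul]
  constructor
  · rintro ⟨c, B, hc, hB⟩
    exact ⟨c⁻¹, inv_ne_zero hc, B, by rw [hB, inv_smul_smul₀ hc]⟩
  · rintro ⟨c, hc, B, hB⟩
    exact ⟨c⁻¹, B, inv_ne_zero hc, by rw [← hB, inv_smul_smul₀ hc]⟩

theorem exists_conjCoeffs_C_mul_eq_self {f : ℂ[X][Y]} (hf : f ≠ 0) {c : ℂ}
    (h : conjCoeffs f = C (C c) * f) :
    ∃ b : ℂ, b ≠ 0 ∧ conjCoeffs (C (C b) * f) = C (C b) * f := by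
  set a := f.leadingCoeff.leadingCoeff
  have ha : a ≠ 0 := leadingCoeff_ne_zero.2 (leadingCoeff_ne_zero.2 hf)
  have hca : conj a = c * a :=
    (coeff_coeff_conjCoeffs f _ _).symm.trans (by rw [h, coeff_C_mul, coeff_C_mul]; rfl)
  have hc : c ≠ 0 := by
    rintro rfl
    rw [zero_mul, map_eq_zero] at hca
    exact ha hca
  refine ⟨a⁻¹, inv_ne_zero ha, ?_⟩
  rw [conjCoeffs_C_mul, h, ← mul_assoc, ← C_mul, ← C_mul, map_inv₀, hca, mul_inv_rev,
    inv_mul_cancel_right₀ hc]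

theorem IsMapOfTuples.exists_conjCoeffs_C_mul_eq_self {d : ℕ} (hd : d ≠ 0) {f : ℂ[X][Y]}
    (hf : IsMapOfTuples d f) (hpow : ¬ IsProperPower d f)
    (h : ∀ x y : ℂ, f.evalEval x y = 0 → f.evalEval (conj x) (conj y) = 0) :
    ∃ c : ℂ, c ≠ 0 ∧ conjCoeffs (C (C c) * f) = C (C c) * f := by
  obtain ⟨c, hc⟩ := hf.exists_eq_C_mul (hf.squarefree hd hpow) (g := conjCoeffs f)
    (natDegree_map_le.trans hf.natDegree_y_le)
    (fun j => by
      rw [conjCoeffs, coeff_map]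
      exact natDegree_map_le.trans (hf.natDegree_x_le j))
    (fun x y hxy => by rw [evalEval_conjCoeffs, h x y hxy, map_zero])
  exact TupleMap.exists_conjCoeffs_C_mul_eq_self hf.ne_zero hc

theorem IsMapOfTuples.exists_ofReal_eq_separated {d : ℕ} (hd : d ≠ 0) {f : ℂ[X][Y]}
    (hf : IsMapOfTuples d f) (hs : Squarefree f) :
    ∃ (x₁ x₂ : ℝ) (K L : ℂ[X]), K.natDegree ≤ d ∧ L.natDegree ≤ d ∧
      LinearIndependent ℂ ![sectionX d f (x₁ : ℂ), sectionX d f (x₂ : ℂ)] ∧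
      f = separated K L (sectionX d f (x₁ : ℂ)) (sectionX d f (x₂ : ℂ)) := by
  have hgen : ∀ᶠ x : ℂ in cofinite, (sectionX d f x).Separable ∧ (sectionX d f x).natDegree = d :=
    (eventually_separable_map_evalRingHom hf.isPrimitive hs).and
      ((eventually_natDegree_map_evalRingHom f).mono fun _ hx => hx.trans hf.natDegree_eq)
  have hreal {P : ℂ → Prop} (hP : ∀ᶠ x in cofinite, P x) : ∃ x : ℝ, P x :=
    (Complex.ofReal_injective.tendsto_cofinite.eventually hP).exists
  obtain ⟨x₁, hs₁, hd₁⟩ := hreal hgen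
  obtain ⟨y₁, hy₁⟩ : ∃ y, f.evalEval (x₁ : ℂ) y = 0 := exists_evalEval_eq_zero (hd₁.trans_ne hd)
  obtain ⟨x₂, ⟨hs₂, hd₂⟩, hx₂⟩ :=
    hreal (hgen.and (eventually_eval_ne_zero (hf.sectionY_ne_zero y₁)))
  have hco := hf.isCoprime_sectionX hy₁ hx₂
  obtain ⟨K, L, hK, hL, h⟩ := hf.exists_eq_separated hd hs₁ hd₁ hs₂ hd₂ hco
  exact ⟨x₁, x₂, K, L, hK, hL, linearIndependent_pair_of_isCoprime hco (hd₁.trans_ne hd), h⟩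

theorem hasRealCoeffs_of_separated {K L M N : ℂ[X]} (h : LinearIndependent ℂ ![M, N])
    (hM : HasRealCoeffs M) (hN : HasRealCoeffs N)
    (hreal : conjCoeffs (separated K L M N) = separated K L M N) :
    HasRealCoeffs K ∧ HasRealCoeffs L := by
  simp only [hasRealCoeffs_iff_map_conj_eq] at *
  rw [conjCoeffs_separated, hM, hN] at hreal
  exact eq_of_separated_eq h hreal

theorem IsMapOfTuples.exists_real_isSeparation {d : ℕ} (hd : d ≠ 0) {f : ℂ[X][Y]}
    (hf : IsMapOfTuples d f) (hpow : ¬ IsProperPower d f) {c : ℂ} (hc : c ≠ 0)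
    (hreal : conjCoeffs (C (C c) * f) = C (C c) * f) :
    ∃ K L M N : ℂ[X], IsSeparation d f K L M N ∧
      HasRealCoeffs K ∧ HasRealCoeffs L ∧ HasRealCoeffs M ∧ HasRealCoeffs N := by
  obtain ⟨x₁, x₂, K, L, hK, hL, hli, h⟩ :=
    hf.exists_ofReal_eq_separated hd (hf.squarefree hd hpow)
  set M := sectionX d f (x₁ : ℂ)
  set N := sectionX d f (x₂ : ℂ)
  have hsection (x : ℝ) : HasRealCoeffs (C c * sectionX d f (x : ℂ)) := by
    have := hasRealCoeffs_sectionX_ofReal d hreal x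
    rwa [sectionX_C_mul_coe] at this
  have hcf : C (C c) * f = separated K L (C c * M) (C c * N) := by
    rw [separated_C_mul, ← h]
  have hli' : LinearIndependent ℂ ![C c * M, C c * N] := by
    simpa only [smul_eq_C_mul] using (LinearIndependent.pair_smul_iff hc).2 hli
  obtain ⟨hKr, hLr⟩ := hasRealCoeffs_of_separated hli' (hsection x₁) (hsection x₂) (hcf ▸ hreal)
  refine ⟨K, L, C c * M, C c * N, (isSeparation_C_mul_iff hc).2 ?_, hKr, hLr, hsection x₁,
    hsection x₂⟩
  have hcor := hf.toIsCorrespondence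
  rw [h] at hcor ⊢
  exact hcor.isSeparation hK hL (natDegree_sectionX_coe_le hf.natDegree_y_le x₁)
    (natDegree_sectionX_coe_le hf.natDegree_y_le x₂)

end TupleMap

theorem theorem2p6 (d : ℕ) (hd : 2 ≤ d) (f : ℂ[X][Y])
    (hf : TupleMap.IsMapOfTuples d f) (hpow : ¬ TupleMap.IsProperPower d f) :
    List.TFAE [
      ∀ x y : ℂ, f.evalEval x y = 0 ↔
        f.evalEval (starRingEnd ℂ x) (starRingEnd ℂ y) = 0,
      ∃ K L M N : Polynomial ℂ, TupleMap.IsSeparation d f K L M N ∧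
        TupleMap.HasRealCoeffs K ∧ TupleMap.HasRealCoeffs L ∧
        TupleMap.HasRealCoeffs M ∧ TupleMap.HasRealCoeffs N,
      ∃ (c : ℂ) (B : Matrix (Fin (d + 1)) (Fin (d + 1)) ℝ), c ≠ 0 ∧
        TupleMap.coeffMatrix d f = c • B.map (fun r : ℝ => (r : ℂ))] := by
  have hd0 : d ≠ 0 := by lia
  rw [TupleMap.exists_coeffMatrix_eq_smul_iff hf.natDegree_y_le hf.natDegree_x_le]
  tfae_have 1 → 3 := fun h => hf.exists_conjCoeffs_C_mul_eq_self hd0 hpow fun x y => (h x y).1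
  tfae_have 3 → 2 := fun ⟨c, hc, hreal⟩ => hf.exists_real_isSeparation hd0 hpow hc hreal
  tfae_have 2 → 1 := fun ⟨K, L, M, N, h, hK, hL, hM, hN⟩ =>
    h.evalEval_conj_eq_zero_iff hK hL hM hN
  tfae_finish
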